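/- Let $F$ be the joint law of a query $(\tilde r,\tilde{\bm a})\in\mathbb{R}_{\ge 0}\times\mathbb{R}^m_{\ge 0}$, where $\tilde{\bm a}$ is supported on a finite set $\mathcal{A}$ (with $P(\tilde{\bm a}=\bm a)>0$ for every $\bm a\in\mathcal A$) and $\mathbb{E}[\tilde r]<\infty$; write $F(x\mid \bm a)=P(\tilde r\le x\mid\tilde{\bm a}=\bm a)$. Let $\Omega\subset\mathbb{R}^m_{\ge 0}$ be a compact convex set, and suppose that there are constants $\underline\alpha,\bar\alpha>0$ such that for all $\bm\mu',\bm\mu''\in\Omega$ \[ \underline\alpha\,\mathbb{E}\big[(\tilde{\bm a}^\top\bm\mu'-\tilde{\bm a}^\top\bm\mu'')^2\big]\le \mathbb{E}\big[(F(\tilde{\bm a}^\top\bm\mu'\mid\tilde{\bm a})-F(\tilde{\bm a}^\top\bm\mu''\mid\tilde{\bm a}))(\tilde{\bm a}^\top\bm\mu'-\tilde{\bm a}^\top\bm\mu'')\big]\le\bar\alpha\,\mathbb{E}\big[(\tilde{\bm a}^\top\bm\mu'-\tilde{\bm a}^\top\bm\mu'')^2\big]. \] For $s\ge 2$, a vector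 $\bm c\ge 0$ of capacities and i.i.d. queries $I=\{(\tilde r_\tau,\tilde{\bm a}_\tau)\}_{\tau=1}^{s-1}$ with law $F$, consider the scaled dual function of the offline linear program and the fluid dual function, \[ L^{\mathrm{Off}}_{\bm c,I}(\bm\mu)=\Big(\frac{\bm c}{s-1}\Big)^\top\bm\mu+\frac1{s-1}\sum_{\tau=1}^{s-1}[\tilde r_\tau-\tilde{\bm a}_\tau^\top\bm\mu]^+,\qquad L^{\mathrm{Fld}}_{\bm c}(\bm\mu)=\Big(\frac{\bm c}{s-1}\Big)^\top\bm\mu+\mathbb{E}_{(\tilde r,\tilde{\bm a})\sim F}[\tilde r-\tilde{\bm a}^\top\bm\mu]^+ . \] Then there are constants $\delta_1>0$ and $t_0\ge 1$, independent of $s$ and $\bm c$, such that for every $s$ with $s-1\ge t_0$, every $\bm c\ge 0$, every (measurable) choice $\tilde{\bm\mu}_1\in\arg\min_{\bm\mu\in\Omega}L^{\mathrm{Off}}_{\bm c,I}(\bm\mu)$, every $\hat{\bm\mu}_1\in\arg\min_{\bm\mu\in\Omega}L^{\mathrm{Fld}}_{\bm c}(\bm\mu)$ and every $\bm a_t\in\mathcal{A}$,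 \[ \mathbb{E}\big[(\bm a_t^\top\tilde{\bm\mu}_1-\bm a_t^\top\hat{\bm\mu}_1)^2\big]\le\frac{\delta_1}{s-1}. \] -/

import Mathlib

open MeasureTheory ProbabilityTheory Set

noncomputable section

/-- A query with `m` resources: the pair `(r, a)` of its reward and its size vector. -/
abbrev Query (m : ℕ) : Type := ℝ × (Fin m → ℝ)

/-- `F` is the law of a query `(r, a)`: rewards and sizes are nonnegative, the size is supported on
the finite set `𝒜` (each of whose elements has positive probability), and the mean reward is
finite. -/
structure IsQueryLaw {m : ℕ} (F : Measure (Query m)) (𝒜 : Finset (Fin m → ℝ)) : Prop where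
  isProb : IsProbabilityMeasure F
  size_nonneg : ∀ a ∈ 𝒜, 0 ≤ a
  size_mem : ∀ᵐ q ∂F, q.2 ∈ 𝒜
  type_pos : ∀ a ∈ 𝒜, F {q | q.2 = a} ≠ 0
  reward_nonneg : ∀ᵐ q ∂F, 0 ≤ q.1
  reward_integrable : Integrable (fun q : Query m => q.1) F

/-- The probability `p_a` that the size of a query is `a`. -/
def typeProb {m : ℕ} (F : Measure (Query m)) (a : Fin m → ℝ) : ℝ :=
  F.real {q | q.2 = a}

/-- The conditional distribution function `F(x | a) = P(r ≤ x | size = a)` of the reward. -/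
def condCdf {m : ℕ} (F : Measure (Query m)) (a : Fin m → ℝ) (x : ℝ) : ℝ :=
  (ProbabilityTheory.cond F {q | q.2 = a}).real {q | q.1 ≤ x}

/-- The growth condition on the set `Ω` of dual variables: for all `μ', μ'' ∈ Ω`,
`αlo E[(aᵀμ' - aᵀμ'')²] ≤ E[(F(aᵀμ' | a) - F(aᵀμ'' | a)) (aᵀμ' - aᵀμ'')]
  ≤ αhi E[(aᵀμ' - aᵀμ'')²]`,
the expectation being over the size `a` of one query. -/
def GrowthCondition {m : ℕ} (F : Measure (Query m)) (𝒜 : Finset (Fin m → ℝ))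
    (Ω : Set (Fin m → ℝ)) (αlo αhi : ℝ) : Prop :=
  ∀ μ' ∈ Ω, ∀ μ'' ∈ Ω,
    αlo * ∑ a ∈ 𝒜, typeProb F a * (a ⬝ᵥ μ' - a ⬝ᵥ μ'') ^ 2
        ≤ ∑ a ∈ 𝒜, typeProb F a *
            ((condCdf F a (a ⬝ᵥ μ') - condCdf F a (a ⬝ᵥ μ'')) * (a ⬝ᵥ μ' - a ⬝ᵥ μ'')) ∧
      ∑ a ∈ 𝒜, typeProb F a *
            ((condCdf F a (a ⬝ᵥ μ') - condCdf F a (a ⬝ᵥ μ'')) * (a ⬝ᵥ μ' - a ⬝ᵥ μ''))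
        ≤ αhi * ∑ a ∈ 𝒜, typeProb F a * (a ⬝ᵥ μ' - a ⬝ᵥ μ'') ^ 2

/-- The sample-average dual function: the dual function, scaled by `1 / N`, of the offline linear
program `max ∑ τ, r_τ x_τ` subject to `∑ τ, a_τ x_τ ≤ c`, `0 ≤ x_τ ≤ 1`, for the `N` queries
`I τ = (r_τ, a_τ)` and capacities `c`. -/
def offDual {m N : ℕ} (c : Fin m → ℝ) (I : Fin N → Query m) (μ : Fin m → ℝ) : ℝ :=
  ((1 / (N : ℝ)) • c) ⬝ᵥ μ + (1 / (N : ℝ)) * ∑ τ : Fin N, max ((I τ).1 - (I τ).2 ⬝ᵥ μ) 0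

/-- `offDual` is the maximum of the scaled Lagrangian of the offline linear program. -/
theorem offDual_isGreatest {m N : ℕ} (c : Fin m → ℝ) (I : Fin N → Query m) (μ : Fin m → ℝ) :
    IsGreatest
      ((fun x : Fin N → ℝ =>
          ((1 / (N : ℝ)) • c) ⬝ᵥ μ + (1 / (N : ℝ)) * ∑ τ : Fin N, ((I τ).1 - (I τ).2 ⬝ᵥ μ) * x τ) ''
        {x | ∀ τ, x τ ∈ Icc (0 : ℝ) 1})
      (offDual c I μ) := by
  constructor
  · refine ⟨fun τ => if 0 ≤ (I τ).1 - (I τ).2 ⬝ᵥ μ then 1 else 0, fun τ => ?_, ?_⟩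
    · dsimp only
      split_ifs <;> simp
    · have h : ∀ τ : Fin N, ((I τ).1 - (I τ).2 ⬝ᵥ μ) *
          (if 0 ≤ (I τ).1 - (I τ).2 ⬝ᵥ μ then (1 : ℝ) else 0)
            = max ((I τ).1 - (I τ).2 ⬝ᵥ μ) 0 := by
        intro τ
        split_ifs with h
        · rw [mul_one, max_eq_left h]
        · rw [mul_zero, max_eq_right (not_le.mp h).le]
      simp only [h, offDual]
  · rintro _ ⟨x, hx, rfl⟩
    unfold offDual
    have h : ∑ τ : Fin N, ((I τ).1 - (I τ).2 ⬝ᵥ μ) * x τ ≤ ∑ τ : Fin N, max ((I τ).1 - (I τ).2 ⬝ᵥ μ) 0 := by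
      refine Finset.sum_le_sum fun τ _ => ?_
      obtain ⟨h0, h1⟩ := hx τ
      calc ((I τ).1 - (I τ).2 ⬝ᵥ μ) * x τ ≤ max ((I τ).1 - (I τ).2 ⬝ᵥ μ) 0 * x τ :=
            mul_le_mul_of_nonneg_right (le_max_left _ _) h0
        _ ≤ max ((I τ).1 - (I τ).2 ⬝ᵥ μ) 0 := mul_le_of_le_one_right (le_max_right _ _) h1
    have hN : (0 : ℝ) ≤ 1 / (N : ℝ) := by positivity
    dsimp only
    gcongr

/-- The fluid dual function with `N` remaining periods: the limiting problem that is approximated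
by the sample-average dual function. -/
def fluidDual {m : ℕ} (F : Measure (Query m)) (N : ℕ) (c μ : Fin m → ℝ) : ℝ :=
  ((1 / (N : ℝ)) • c) ⬝ᵥ μ + ∫ q : Query m, max (q.1 - q.2 ⬝ᵥ μ) 0 ∂F

/-- The set of minimizers of `f` over `Ω`. -/
def argminOn {E : Type*} (f : E → ℝ) (Ω : Set E) : Set E :=
  {μ | μ ∈ Ω ∧ ∀ ν ∈ Ω, f μ ≤ f ν}

end

/-!
Write `h_a(u)` for the deviation (`tailDev`) of the empirical probability that a query has size `a`
and reward above `u` from its true value. Since `[r - y]⁺ - [r - x]⁺ = -∫_x^y 1{u < r} du`, the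
increments of both dual functions are integrals of joint tails, and the capacity terms cancel in
their difference. As the sample minimizer `μ` is at least as good as the fluid minimizer `μhat` for
the sample-average dual, the fluid gap is at most
`∑ a, ∫ u in (a ⬝ᵥ μhat)..(a ⬝ᵥ μ), h_a(u)` (`fluidDual_sub_le_sum_tailDev`). The lower growth
bound makes this gap at least a multiple of `E[(aᵀμ - aᵀμhat)²]` (`quadratic_growth_fluidDual`).

It remains to bound the integral by `|aᵀμ - aᵀμhat|` times a quantity of mean square `O(1 / N)`.
No uniform bound on `h_a` is needed. Put `x = a ⬝ᵥ μhat`, which is deterministic, and split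
`h_a(u) = h_a(x) + (h_a(u) - h_a(x))`. The first term has variance at most `1 / N`. The
second has variance at most `K |u - x| / N`, because the upper growth bound makes the tails
Lipschitz (`exists_lipschitz_tailProb`); so a Cauchy–Schwarz inequality with weight `|u - x|`
(`enorm_intervalIntegral_le`) bounds its integral in terms of
`tailOsc = ∫ (h_a(u) - h_a(x))² / |u - x| du`, whose mean is `O(1 / N)` by Tonelli's theorem
(`lintegral_tailOsc_le`). This gives the rate `1 / N` without logarithmic factors.
-/

/-! ### Joint tails of size and reward -/

/-- The indicator of the event that a query has size `a` and reward larger than `u`. -/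
noncomputable def tailInd {m : ℕ} (a : Fin m → ℝ) (u : ℝ) : Query m → ℝ :=
  indicator {q | q.2 = a ∧ u < q.1} 1

/-- The probability that a query has size `a` and reward larger than `u`, that is,
`p_a (1 - F(u | a))`. -/
noncomputable def tailProb {m : ℕ} (F : Measure (Query m)) (a : Fin m → ℝ) (u : ℝ) : ℝ :=
  F.real {q | q.2 = a ∧ u < q.1}

/-- The deviation of the empirical joint tail of the sample `I` from the joint tail of the law
`F`. -/
noncomputable def tailDev {m N : ℕ} (F : Measure (Query m)) (I : Fin N → Query m) (a : Fin m → ℝ)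
    (u : ℝ) : ℝ :=
  1 / (N : ℝ) * ∑ τ, tailInd a u (I τ) - tailProb F a u

section Tail

variable {m : ℕ} {F : Measure (Query m)} {𝒜 : Finset (Fin m → ℝ)} (a : Fin m → ℝ)

theorem tailInd_eq (u : ℝ) (q : Query m) [Decidable (q.2 = a)] :
    tailInd a u q = if q.2 = a then (if u < q.1 then 1 else 0) else 0 := by
  unfold tailInd
  by_cases h : q.2 = a <;> by_cases h' : u < q.1 <;> simp [h, h']

theorem abs_tailInd_le_one (u : ℝ) (q : Query m) : |tailInd a u q| ≤ 1 := by
  classical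
  rw [tailInd_eq]
  split_ifs <;> simp

theorem measurableSet_tail (u : ℝ) : MeasurableSet {q : Query m | q.2 = a ∧ u < q.1} :=
  (measurableSet_eq_fun measurable_snd measurable_const).inter
    (measurableSet_lt measurable_const measurable_fst)

theorem measurable_uncurry_tailInd :
    Measurable (fun p : ℝ × Query m => tailInd a p.1 p.2) := by
  have h : (fun p : ℝ × Query m => tailInd a p.1 p.2)
      = indicator {p | p.2.2 = a ∧ p.1 < p.2.1} 1 := rfl
  rw [h]
  refine measurable_one.indicator (MeasurableSet.inter ?_ ?_)
  · exact measurableSet_eq_fun (measurable_snd.comp measurable_snd) measurable_const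
  · exact measurableSet_lt measurable_fst (measurable_fst.comp measurable_snd)

theorem measurable_tailInd (u : ℝ) : Measurable (tailInd (m := m) a u) :=
  measurable_one.indicator (measurableSet_tail a u)

theorem integral_tailInd (u : ℝ) : ∫ q, tailInd a u q ∂F = tailProb F a u := by
  simp only [tailInd]
  rw [integral_indicator_one (measurableSet_tail a u)]
  rfl

theorem tailProb_antitone [IsFiniteMeasure F] : Antitone (tailProb F a) := fun _ _ h =>
  measureReal_mono fun _ hq => ⟨hq.1, h.trans_lt hq.2⟩

theorem intervalIntegrable_tailInd (q : Query m) (x y : ℝ) :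
    IntervalIntegrable (fun u => tailInd a u q) volume x y := by
  refine (intervalIntegrable_const (c := (1 : ℝ))).mono_fun ?_ ?_
  · exact ((measurable_uncurry_tailInd a).comp
      (measurable_id.prodMk measurable_const)).aestronglyMeasurable
  · exact Filter.Eventually.of_forall fun u => by simpa using abs_tailInd_le_one a u q

/-- The positive part `[r - x]⁺` is the integral of the indicator of `u < r` over `u > x`. -/
theorem max_sub_zero_sub_max_sub_zero (r x y : ℝ) :
    max (r - y) 0 - max (r - x) 0 = -∫ u in x..y, if u < r then (1 : ℝ) else 0 := by
  have hint : IntervalIntegrable (fun u : ℝ => if u < r then (1 : ℝ) else 0) volume x y := by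
    refine (intervalIntegrable_const (c := (1 : ℝ))).mono_fun ?_ ?_
    · exact (Measurable.ite measurableSet_Iio measurable_const
        measurable_const).aestronglyMeasurable
    · exact Filter.Eventually.of_forall fun u => by dsimp only; split_ifs <;> simp
  -- The integrand is the right derivative of `u ↦ min u r` everywhere, also at the kink `u = r`.
  rw [intervalIntegral.integral_eq_sub_of_hasDeriv_right (f := fun u => min u r) _ _ hint]
  · rcases le_total y r with h | h <;> rcases le_total x r with h' | h' <;> simp [h, h']
  · fun_prop
  · intro u _
    split_ifs with h
    · refine ((hasDerivAt_id u).congr_of_eventuallyEq ?_).hasDerivWithinAt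
      filter_upwards [Iio_mem_nhds h] with v hv
      exact min_eq_left (le_of_lt hv)
    · refine (hasDerivWithinAt_const u (Ioi u) r).congr (fun v hv => ?_) ?_
      · exact min_eq_right ((not_lt.mp h).trans (le_of_lt hv))
      · exact min_eq_right (not_lt.mp h)

/-- The change of the dual contribution of a query between `μ` and `μ'`, as an integral of tail
indicators. Only the summand of the size of the query is nonzero. -/
theorem surplus_sub_surplus {q : Query m} (hq : q.2 ∈ 𝒜) (μ μ' : Fin m → ℝ) :
    max (q.1 - q.2 ⬝ᵥ μ') 0 - max (q.1 - q.2 ⬝ᵥ μ) 0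
      = -∑ a ∈ 𝒜, ∫ u in (a ⬝ᵥ μ)..(a ⬝ᵥ μ'), tailInd a u q := by
  classical
  rw [max_sub_zero_sub_max_sub_zero, Finset.sum_eq_single_of_mem _ hq]
  · simp [tailInd_eq]
  · intro b _ hb
    simp [tailInd_eq, hb.symm]

theorem intervalIntegrable_tailProb [IsFiniteMeasure F] (x y : ℝ) :
    IntervalIntegrable (tailProb F a) volume x y :=
  (tailProb_antitone a).intervalIntegrable

theorem integrable_uncurry_tailInd [IsFiniteMeasure F] (x y : ℝ) :
    Integrable (Function.uncurry fun u q => tailInd a u q)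
      ((volume.restrict (uIoc x y)).prod F) := by
  have : IsFiniteMeasure (volume.restrict (uIoc x y)) :=
    isFiniteMeasure_restrict.2 measure_Ioc_lt_top.ne
  refine (integrable_const (1 : ℝ)).mono' (measurable_uncurry_tailInd a).aestronglyMeasurable ?_
  exact Filter.Eventually.of_forall fun p => abs_tailInd_le_one a p.1 p.2

theorem integral_intervalIntegral_tailInd [IsFiniteMeasure F] (x y : ℝ) :
    ∫ q, (∫ u in x..y, tailInd a u q) ∂F = ∫ u in x..y, tailProb F a u := by
  rw [← intervalIntegral_integral_swap (integrable_uncurry_tailInd a x y)]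
  simp only [integral_tailInd]

theorem integrable_intervalIntegral_tailInd [IsFiniteMeasure F] (x y : ℝ) :
    Integrable (fun q => ∫ u in x..y, tailInd a u q) F := by
  simp only [intervalIntegral.intervalIntegral_eq_integral_uIoc]
  exact (integrable_uncurry_tailInd a x y).integral_prod_right.smul (if x ≤ y then 1 else -1 : ℝ)

/-! ### Increments of the dual functions -/

theorem integrable_surplus (hF : IsQueryLaw F 𝒜) (μ : Fin m → ℝ) :
    Integrable (fun q : Query m => max (q.1 - q.2 ⬝ᵥ μ) 0) F := by
  have := hF.isProb
  have hm : Measurable (fun q : Query m => q.2 ⬝ᵥ μ) := by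
    unfold dotProduct
    fun_prop
  refine (hF.reward_integrable.abs.add (integrable_const (∑ a ∈ 𝒜, |a ⬝ᵥ μ|))).mono'
    ((measurable_fst.sub hm).max measurable_const).aestronglyMeasurable ?_
  filter_upwards [hF.size_mem] with q hq
  have h1 : |q.2 ⬝ᵥ μ| ≤ ∑ a ∈ 𝒜, |a ⬝ᵥ μ| :=
    Finset.single_le_sum (f := fun a => |a ⬝ᵥ μ|) (fun _ _ => abs_nonneg _) hq
  have h2 : |max (q.1 - q.2 ⬝ᵥ μ) 0| ≤ |q.1 - q.2 ⬝ᵥ μ| := by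
    rw [abs_of_nonneg (le_max_right _ _)]
    exact max_le (le_abs_self _) (abs_nonneg _)
  have h3 := abs_sub q.1 (q.2 ⬝ᵥ μ)
  simp only [Real.norm_eq_abs, Pi.add_apply]
  linarith

theorem fluidDual_sub_fluidDual (hF : IsQueryLaw F 𝒜) (N : ℕ) (c μ μ' : Fin m → ℝ) :
    fluidDual F N c μ' - fluidDual F N c μ
      = ((1 / (N : ℝ)) • c) ⬝ᵥ (μ' - μ)
        - ∑ a ∈ 𝒜, ∫ u in (a ⬝ᵥ μ)..(a ⬝ᵥ μ'), tailProb F a u := by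
  have := hF.isProb
  have h : ∫ q : Query m, max (q.1 - q.2 ⬝ᵥ μ') 0 ∂F - ∫ q : Query m, max (q.1 - q.2 ⬝ᵥ μ) 0 ∂F
      = -∑ a ∈ 𝒜, ∫ u in (a ⬝ᵥ μ)..(a ⬝ᵥ μ'), tailProb F a u := by
    rw [← integral_sub (integrable_surplus hF μ') (integrable_surplus hF μ)]
    have h1 : (fun q : Query m => max (q.1 - q.2 ⬝ᵥ μ') 0 - max (q.1 - q.2 ⬝ᵥ μ) 0) =ᵐ[F]
        fun q => -∑ a ∈ 𝒜, ∫ u in (a ⬝ᵥ μ)..(a ⬝ᵥ μ'), tailInd a u q := by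
      filter_upwards [hF.size_mem] with q hq
      exact surplus_sub_surplus hq μ μ'
    rw [integral_congr_ae h1, integral_neg,
      integral_finsetSum _ fun a _ => integrable_intervalIntegral_tailInd a _ _]
    simp only [integral_intervalIntegral_tailInd]
  unfold fluidDual
  rw [dotProduct_sub]
  linarith

theorem offDual_sub_offDual {N : ℕ} {I : Fin N → Query m} (hI : ∀ τ, (I τ).2 ∈ 𝒜)
    (c μ μ' : Fin m → ℝ) :
    offDual c I μ' - offDual c I μ
      = ((1 / (N : ℝ)) • c) ⬝ᵥ (μ' - μ)
        - ∑ a ∈ 𝒜, ∫ u in (a ⬝ᵥ μ)..(a ⬝ᵥ μ'), 1 / (N : ℝ) * ∑ τ, tailInd a u (I τ) := by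
  have h : ∑ τ, max ((I τ).1 - (I τ).2 ⬝ᵥ μ') 0 - ∑ τ, max ((I τ).1 - (I τ).2 ⬝ᵥ μ) 0
      = -∑ a ∈ 𝒜, ∫ u in (a ⬝ᵥ μ)..(a ⬝ᵥ μ'), ∑ τ, tailInd a u (I τ) := by
    rw [← Finset.sum_sub_distrib, Finset.sum_congr rfl fun τ _ => surplus_sub_surplus (hI τ) μ μ',
      Finset.sum_neg_distrib, Finset.sum_comm]
    refine congrArg _ (Finset.sum_congr rfl fun a _ => ?_)
    rw [intervalIntegral.integral_finsetSum fun τ _ => intervalIntegrable_tailInd a (I τ) _ _]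
  unfold offDual
  simp only [intervalIntegral.integral_const_mul, ← Finset.mul_sum, dotProduct_sub]
  linear_combination (1 / (N : ℝ)) * h

/-- The increments of the fluid dual function exceed those of the sample-average dual function by
integrals of the tail deviations, since the linear capacity terms cancel. The latter increment is
nonpositive here. -/
theorem fluidDual_sub_le_sum_tailDev (hF : IsQueryLaw F 𝒜) {N : ℕ} {I : Fin N → Query m}
    (hI : ∀ τ, (I τ).2 ∈ 𝒜) (c : Fin m → ℝ) {μ μ' : Fin m → ℝ}
    (hμ : offDual c I μ' ≤ offDual c I μ) :
    fluidDual F N c μ' - fluidDual F N c μ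
      ≤ ∑ a ∈ 𝒜, ∫ u in (a ⬝ᵥ μ)..(a ⬝ᵥ μ'), tailDev F I a u := by
  have := hF.isProb
  have h1 := fluidDual_sub_fluidDual hF N c μ μ'
  have h2 := offDual_sub_offDual hI c μ μ'
  have h3 : ∑ a ∈ 𝒜, ∫ u in (a ⬝ᵥ μ)..(a ⬝ᵥ μ'), tailDev F I a u
      = ∑ a ∈ 𝒜, (∫ u in (a ⬝ᵥ μ)..(a ⬝ᵥ μ'), 1 / (N : ℝ) * ∑ τ, tailInd a u (I τ))
        - ∑ a ∈ 𝒜, ∫ u in (a ⬝ᵥ μ)..(a ⬝ᵥ μ'), tailProb F a u := by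
    rw [← Finset.sum_sub_distrib]
    refine Finset.sum_congr rfl fun a _ => ?_
    rw [← intervalIntegral.integral_sub _ (intervalIntegrable_tailProb a _ _)]
    · rfl
    · refine IntervalIntegrable.const_mul ⟨?_, ?_⟩ _
      · exact integrable_finsetSum _ fun τ _ => (intervalIntegrable_tailInd a (I τ) _ _).1
      · exact integrable_finsetSum _ fun τ _ => (intervalIntegrable_tailInd a (I τ) _ _).2
  linarith

/-! ### Quadratic growth of the fluid dual function -/

theorem typeProb_mul_condCdf [IsFiniteMeasure F] (u : ℝ) :
    typeProb F a * condCdf F a u = typeProb F a - tailProb F a u := by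
  have hs : MeasurableSet {q : Query m | q.2 = a} :=
    measurableSet_eq_fun measurable_snd measurable_const
  have ht : MeasurableSet {q : Query m | q.1 ≤ u} :=
    measurableSet_le measurable_fst measurable_const
  have h1 : typeProb F a * condCdf F a u = F.real ({q | q.2 = a} ∩ {q | q.1 ≤ u}) := by
    unfold typeProb condCdf
    simp only [measureReal_def, cond_apply hs, ENNReal.toReal_mul, ENNReal.toReal_inv]
    simp only [← measureReal_def]
    rcases eq_or_ne (F.real {q | q.2 = a}) 0 with h | h
    · rw [h, zero_mul]
      exact le_antisymm measureReal_nonneg ((measureReal_mono inter_subset_left).trans_eq h)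
    · field_simp
  have h2 : {q : Query m | q.2 = a ∧ u < q.1} = {q | q.2 = a} \ {q | q.1 ≤ u} := by
    ext q
    simp
  have h3 := measureReal_inter_add_sdiff (μ := F) (s := {q | q.2 = a}) ht
  rw [h1, tailProb, typeProb, h2]
  linarith

theorem growthCondition_iff_tailProb [IsFiniteMeasure F] {Ω : Set (Fin m → ℝ)} {αlo αhi : ℝ} :
    GrowthCondition F 𝒜 Ω αlo αhi ↔ ∀ μ' ∈ Ω, ∀ μ'' ∈ Ω,
      αlo * ∑ a ∈ 𝒜, typeProb F a * (a ⬝ᵥ μ' - a ⬝ᵥ μ'') ^ 2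
        ≤ ∑ a ∈ 𝒜, (tailProb F a (a ⬝ᵥ μ'') - tailProb F a (a ⬝ᵥ μ')) * (a ⬝ᵥ μ' - a ⬝ᵥ μ'') ∧
      ∑ a ∈ 𝒜, (tailProb F a (a ⬝ᵥ μ'') - tailProb F a (a ⬝ᵥ μ')) * (a ⬝ᵥ μ' - a ⬝ᵥ μ'')
        ≤ αhi * ∑ a ∈ 𝒜, typeProb F a * (a ⬝ᵥ μ' - a ⬝ᵥ μ'') ^ 2 := by
  unfold GrowthCondition
  have h : ∀ (a μ' μ'' : Fin m → ℝ), typeProb F a *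
      ((condCdf F a (a ⬝ᵥ μ') - condCdf F a (a ⬝ᵥ μ'')) * (a ⬝ᵥ μ' - a ⬝ᵥ μ''))
      = (tailProb F a (a ⬝ᵥ μ'') - tailProb F a (a ⬝ᵥ μ')) * (a ⬝ᵥ μ' - a ⬝ᵥ μ'') := by
    intro a μ' μ''
    have h1 := typeProb_mul_condCdf (F := F) a (a ⬝ᵥ μ')
    have h2 := typeProb_mul_condCdf (F := F) a (a ⬝ᵥ μ'')
    linear_combination (a ⬝ᵥ μ' - a ⬝ᵥ μ'') * (h1 - h2)
  simp only [h]

/-- The subgradient inequality of the fluid dual function at `μ`. -/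
theorem subgradient_le_fluidDual_sub (hF : IsQueryLaw F 𝒜) (N : ℕ) (c μ μ' : Fin m → ℝ) :
    ((1 / (N : ℝ)) • c) ⬝ᵥ (μ' - μ) - ∑ a ∈ 𝒜, tailProb F a (a ⬝ᵥ μ) * (a ⬝ᵥ (μ' - μ))
      ≤ fluidDual F N c μ' - fluidDual F N c μ := by
  have := hF.isProb
  rw [fluidDual_sub_fluidDual hF]
  refine sub_le_sub_left (Finset.sum_le_sum fun a _ => ?_) _
  have hT := tailProb_antitone (F := F) a
  rw [dotProduct_sub]
  rcases le_total (a ⬝ᵥ μ) (a ⬝ᵥ μ') with h | h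
  · calc ∫ u in (a ⬝ᵥ μ)..(a ⬝ᵥ μ'), tailProb F a u
        ≤ ∫ _ in (a ⬝ᵥ μ)..(a ⬝ᵥ μ'), tailProb F a (a ⬝ᵥ μ) :=
          intervalIntegral.integral_mono_on h hT.intervalIntegrable intervalIntegrable_const
            fun u hu => hT hu.1
      _ = tailProb F a (a ⬝ᵥ μ) * (a ⬝ᵥ μ' - a ⬝ᵥ μ) := by
          rw [intervalIntegral.integral_const, smul_eq_mul, mul_comm]
  · have h1 : ∫ _ in (a ⬝ᵥ μ')..(a ⬝ᵥ μ), tailProb F a (a ⬝ᵥ μ)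
        ≤ ∫ u in (a ⬝ᵥ μ')..(a ⬝ᵥ μ), tailProb F a u :=
      intervalIntegral.integral_mono_on h intervalIntegrable_const hT.intervalIntegrable
        fun u hu => hT hu.2
    rw [intervalIntegral.integral_const, smul_eq_mul] at h1
    rw [intervalIntegral.integral_symm]
    linarith

/-- Quadratic growth of the fluid dual function around a minimizer. The lower bound of the growth
condition says that its subgradients are strongly monotone in the seminorm `E[(aᵀv)²]`. -/
theorem quadratic_growth_fluidDual (hF : IsQueryLaw F 𝒜) {Ω : Set (Fin m → ℝ)}
    (hΩ : Convex ℝ Ω) {αlo αhi : ℝ} (hgrowth : GrowthCondition F 𝒜 Ω αlo αhi) {N : ℕ}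
    {c μhat μ : Fin m → ℝ} (hhat : μhat ∈ argminOn (fluidDual F N c) Ω) (hμ : μ ∈ Ω) :
    αlo / 8 * ∑ a ∈ 𝒜, typeProb F a * (a ⬝ᵥ μ - a ⬝ᵥ μhat) ^ 2
      ≤ fluidDual F N c μ - fluidDual F N c μhat := by
  have := hF.isProb
  obtain ⟨hhatΩ, hmin⟩ := hhat
  -- The points one quarter and one half of the way from `μhat` to `μ`: minimality makes the
  -- directional subgradient nonnegative at the first, strong monotonicity makes it of order
  -- `E[(aᵀv)²]` at the second.
  set v := μ - μhat with hv
  set p := μhat + (1 / 4 : ℝ) • v with hp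
  set p' := μhat + (1 / 2 : ℝ) • v with hp'
  have hpΩ : p ∈ Ω := by
    have := hΩ hhatΩ hμ (a := 3 / 4) (b := 1 / 4) (by norm_num) (by norm_num) (by norm_num)
    convert this using 1
    rw [hp, hv]
    module
  have hp'Ω : p' ∈ Ω := by
    have := hΩ hhatΩ hμ (a := 1 / 2) (b := 1 / 2) (by norm_num) (by norm_num) (by norm_num)
    convert this using 1
    rw [hp', hv]
    module
  have h1 := subgradient_le_fluidDual_sub hF N c p μhat
  have h2 := subgradient_le_fluidDual_sub hF N c p' μ
  have h3 := ((growthCondition_iff_tailProb (F := F)).1 hgrowth p' hp'Ω p hpΩ).1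
  have e1 : μhat - p = (-1 / 4 : ℝ) • v := by rw [hp]; module
  have e2 : μ - p' = (1 / 2 : ℝ) • v := by rw [hp', hv]; module
  have e3 : ∀ a : Fin m → ℝ, a ⬝ᵥ p' - a ⬝ᵥ p = (1 / 4) * (a ⬝ᵥ v) := by
    intro a
    rw [← dotProduct_sub, show p' - p = (1 / 4 : ℝ) • v by rw [hp', hp]; module,
      dotProduct_smul, smul_eq_mul]
  have e4 : ∀ a : Fin m → ℝ, a ⬝ᵥ μ - a ⬝ᵥ μhat = a ⬝ᵥ v := fun a => by rw [← dotProduct_sub]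
  rw [e1] at h1
  rw [e2] at h2
  simp only [e4]
  simp only [e3] at h3
  simp only [dotProduct_smul, smul_eq_mul, mul_left_comm _ (-1 / 4 : ℝ),
    mul_left_comm _ (1 / 2 : ℝ), mul_left_comm _ (1 / 4 : ℝ), ← Finset.mul_sum, mul_pow, sub_mul,
    Finset.sum_sub_distrib, mul_left_comm _ ((1 / 4 : ℝ) ^ 2)] at h1 h2 h3
  have h4 := hmin p hpΩ
  have h5 := hmin p' hp'Ω
  linarith

end Tail

/-! ### Fluctuations of the empirical joint tails -/

section Fluctuation

variable {m : ℕ} {F : Measure (Query m)} {𝒜 : Finset (Fin m → ℝ)} {a : Fin m → ℝ}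

/-- Along the segment joining a minimizer and a maximizer of `a ⬝ᵥ ·` over `Ω`, the differences
`b ⬝ᵥ μ - b ⬝ᵥ μ'` of all sizes `b` are proportional to that of `a`; hence the upper bound of the
growth condition, which only controls the sum over all sizes, makes each tail Lipschitz on the
range of `a ⬝ᵥ ·` over `Ω`. -/
theorem exists_lipschitz_tailProb [IsFiniteMeasure F] {Ω : Set (Fin m → ℝ)} (hΩ : IsCompact Ω)
    (hΩ' : Convex ℝ Ω) {αlo αhi : ℝ} (hgrowth : GrowthCondition F 𝒜 Ω αlo αhi) (ha : a ∈ 𝒜) :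
    ∃ K : ℝ, 0 ≤ K ∧ ∀ x ∈ (fun μ => a ⬝ᵥ μ) '' Ω, ∀ y ∈ (fun μ => a ⬝ᵥ μ) '' Ω,
      |tailProb F a y - tailProb F a x| ≤ K * |y - x| := by
  rcases Ω.eq_empty_or_nonempty with rfl | hne
  · exact ⟨0, le_rfl, by simp⟩
  have hcont : ContinuousOn (fun μ : Fin m → ℝ => a ⬝ᵥ μ) Ω := by
    unfold dotProduct
    fun_prop
  obtain ⟨μ₁, hμ₁, hmin⟩ := hΩ.exists_isMinOn hne hcont
  obtain ⟨μ₂, hμ₂, hmax⟩ := hΩ.exists_isMaxOn hne hcont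
  set l := a ⬝ᵥ μ₂ - a ⬝ᵥ μ₁ with hl
  set B := ∑ b ∈ 𝒜, typeProb F b * (b ⬝ᵥ (μ₂ - μ₁)) ^ 2 with hB
  refine ⟨|αhi * B / l ^ 2|, abs_nonneg _, ?_⟩
  rintro _ ⟨μ, hμ, rfl⟩ _ ⟨μ', hμ', rfl⟩
  dsimp only
  rcases eq_or_ne (a ⬝ᵥ μ') (a ⬝ᵥ μ) with heq | hne'
  · simp [heq]
  have hlpos : 0 < l := by
    have h1 : a ⬝ᵥ μ₁ ≤ a ⬝ᵥ μ := hmin hμ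
    have h2 : a ⬝ᵥ μ ≤ a ⬝ᵥ μ₂ := hmax hμ
    have h3 : a ⬝ᵥ μ₁ ≤ a ⬝ᵥ μ' := hmin hμ'
    have h4 : a ⬝ᵥ μ' ≤ a ⬝ᵥ μ₂ := hmax hμ'
    rcases lt_or_gt_of_ne hne' with h | h <;> linarith
  -- Replace `μ` by the point of the segment with the same value of `a ⬝ᵥ ·`.
  have hseg : ∀ ν ∈ Ω, μ₁ + ((a ⬝ᵥ ν - a ⬝ᵥ μ₁) / l) • (μ₂ - μ₁) ∈ Ω ∧
      a ⬝ᵥ (μ₁ + ((a ⬝ᵥ ν - a ⬝ᵥ μ₁) / l) • (μ₂ - μ₁)) = a ⬝ᵥ ν := by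
    intro ν hν
    have h1 : a ⬝ᵥ μ₁ ≤ a ⬝ᵥ ν := hmin hν
    have h2 : a ⬝ᵥ ν ≤ a ⬝ᵥ μ₂ := hmax hν
    refine ⟨hΩ'.add_smul_sub_mem hμ₁ hμ₂ ⟨by positivity [sub_nonneg.2 h1], ?_⟩, ?_⟩
    · rw [div_le_one hlpos]
      linarith
    · rw [dotProduct_add, dotProduct_smul, dotProduct_sub, ← hl, smul_eq_mul,
        div_mul_cancel₀ _ hlpos.ne']
      ring
  obtain ⟨hp, hpa⟩ := hseg μ hμ
  obtain ⟨hp', hpa'⟩ := hseg μ' hμ'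
  set s := (a ⬝ᵥ μ - a ⬝ᵥ μ₁) / l with hs
  set s' := (a ⬝ᵥ μ' - a ⬝ᵥ μ₁) / l with hs'
  have hg := ((growthCondition_iff_tailProb (F := F)).1 hgrowth _ hp' _ hp).2
  have hdiff : ∀ b : Fin m → ℝ, b ⬝ᵥ (μ₁ + s' • (μ₂ - μ₁)) - b ⬝ᵥ (μ₁ + s • (μ₂ - μ₁))
      = (s' - s) * (b ⬝ᵥ (μ₂ - μ₁)) := by
    intro b
    simp only [dotProduct_add, dotProduct_smul, smul_eq_mul]
    ring
  have hsum : ∑ b ∈ 𝒜, typeProb F b *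
      (b ⬝ᵥ (μ₁ + s' • (μ₂ - μ₁)) - b ⬝ᵥ (μ₁ + s • (μ₂ - μ₁))) ^ 2 = (s' - s) ^ 2 * B := by
    simp only [hdiff, hB, Finset.mul_sum]
    exact Finset.sum_congr rfl fun b _ => by ring
  have hnonneg : ∀ (b : Fin m → ℝ) (x y : ℝ), 0 ≤ (tailProb F b x - tailProb F b y) * (y - x) := by
    intro b x y
    rcases le_total x y with h | h
    · exact mul_nonneg (sub_nonneg.2 (tailProb_antitone b h)) (sub_nonneg.2 h)
    · exact mul_nonneg_of_nonpos_of_nonpos (sub_nonpos.2 (tailProb_antitone b h)) (sub_nonpos.2 h)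
  have hterm := (Finset.single_le_sum (fun b _ => hnonneg b (b ⬝ᵥ (μ₁ + s • (μ₂ - μ₁)))
    (b ⬝ᵥ (μ₁ + s' • (μ₂ - μ₁)))) ha).trans hg
  rw [hsum, hpa, hpa'] at hterm
  have hss : s' - s = (a ⬝ᵥ μ' - a ⬝ᵥ μ) / l := by
    rw [hs, hs', ← sub_div]
    ring
  have hpos : 0 < |a ⬝ᵥ μ' - a ⬝ᵥ μ| := abs_pos.2 (sub_ne_zero.2 hne')
  refine le_of_mul_le_mul_right ?_ hpos
  calc |tailProb F a (a ⬝ᵥ μ') - tailProb F a (a ⬝ᵥ μ)| * |a ⬝ᵥ μ' - a ⬝ᵥ μ|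
      = (tailProb F a (a ⬝ᵥ μ) - tailProb F a (a ⬝ᵥ μ')) * (a ⬝ᵥ μ' - a ⬝ᵥ μ) := by
        rw [← abs_of_nonneg (hnonneg a (a ⬝ᵥ μ) (a ⬝ᵥ μ')), abs_mul, abs_sub_comm]
    _ ≤ αhi * ((s' - s) ^ 2 * B) := hterm
    _ = αhi * B / l ^ 2 * |a ⬝ᵥ μ' - a ⬝ᵥ μ| ^ 2 := by
        rw [hss, sq_abs]
        field_simp
    _ ≤ |αhi * B / l ^ 2| * |a ⬝ᵥ μ' - a ⬝ᵥ μ| ^ 2 := by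
        gcongr
        exact le_abs_self _
    _ = |αhi * B / l ^ 2| * |a ⬝ᵥ μ' - a ⬝ᵥ μ| * |a ⬝ᵥ μ' - a ⬝ᵥ μ| := by ring

/-- The mean square error of an average of `N` independent copies of a bounded variable. -/
theorem lintegral_sq_average_sub_integral_le {E S : Type*} [MeasurableSpace E] [MeasurableSpace S]
    {F : Measure E} [IsProbabilityMeasure F] {Pr : Measure S} [IsProbabilityMeasure Pr] {N : ℕ}
    (hN : 0 < N) {I : Fin N → S → E} (hI : ∀ τ, HasLaw (I τ) F Pr) (hind : iIndepFun I Pr)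
    {f : E → ℝ} (hf : Measurable f) {C : ℝ} (hC : ∀ q, |f q| ≤ C) :
    ∫⁻ ω, ENNReal.ofReal ((1 / (N : ℝ) * ∑ τ, f (I τ ω) - ∫ q, f q ∂F) ^ 2) ∂Pr
      ≤ ENNReal.ofReal ((∫ q, f q ^ 2 ∂F) / N) := by
  have hN' : (N : ℝ) ≠ 0 := by positivity
  have hmem : ∀ τ, MemLp (fun ω => f (I τ ω)) 2 Pr := fun τ =>
    MemLp.of_bound (hf.comp_aemeasurable (hI τ).aemeasurable).aestronglyMeasurable C
      (Filter.Eventually.of_forall fun ω => hC _)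
  have hmemsum : MemLp (∑ τ, fun ω => f (I τ ω)) 2 Pr := memLp_finsetSum' _ fun τ _ => hmem τ
  have hmean : Pr[fun ω => 1 / (N : ℝ) * (∑ τ, fun ω => f (I τ ω)) ω] = ∫ q, f q ∂F := by
    simp only [Finset.sum_apply]
    rw [integral_const_mul, integral_finsetSum _ fun τ _ => (hmem τ).integrable one_le_two]
    have h : ∀ τ, ∫ ω, f (I τ ω) ∂Pr = ∫ q, f q ∂F := fun τ =>
      (hI τ).integral_comp hf.aestronglyMeasurable
    simp only [h, Finset.sum_const, Finset.card_univ, Fintype.card_fin, nsmul_eq_mul]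
    field_simp
  have hvar : Var[fun ω => 1 / (N : ℝ) * (∑ τ, fun ω => f (I τ ω)) ω; Pr]
      ≤ (∫ q, f q ^ 2 ∂F) / N := by
    rw [variance_const_mul, IndepFun.variance_sum (fun τ _ => hmem τ)
      fun i _ j _ hij => (hind.indepFun hij).comp hf hf]
    have h : ∀ τ, Var[fun ω => f (I τ ω); Pr] ≤ ∫ q, f q ^ 2 ∂F := fun τ => by
      refine (variance_le_expectation_sq (hmem τ).aestronglyMeasurable).trans_eq ?_
      exact (hI τ).integral_comp (hf.pow_const 2).aestronglyMeasurable
    calc (1 / (N : ℝ)) ^ 2 * ∑ τ, Var[fun ω => f (I τ ω); Pr]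
        ≤ (1 / (N : ℝ)) ^ 2 * ∑ _τ : Fin N, ∫ q, f q ^ 2 ∂F := by
          gcongr with τ
          exact h τ
      _ = (∫ q, f q ^ 2 ∂F) / N := by
          rw [Finset.sum_const, Finset.card_univ, Fintype.card_fin, nsmul_eq_mul]
          field_simp
  refine le_trans (le_of_eq ?_) (ENNReal.ofReal_le_ofReal hvar)
  rw [ofReal_variance (hmemsum.const_mul _), evariance_eq_lintegral_ofReal, hmean]
  simp only [Finset.sum_apply]

variable {S : Type*} [MeasurableSpace S] {Pr : Measure S} [IsProbabilityMeasure Pr] {N : ℕ}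
  {I : Fin N → S → Query m}

theorem lintegral_sq_tailDev_le [IsProbabilityMeasure F] (hN : 0 < N)
    (hI : ∀ τ, HasLaw (I τ) F Pr) (hind : iIndepFun I Pr) (x : ℝ) :
    ∫⁻ ω, ENNReal.ofReal (tailDev F (fun τ => I τ ω) a x ^ 2) ∂Pr
      ≤ ENNReal.ofReal (1 / N) := by
  have h := lintegral_sq_average_sub_integral_le hN hI hind (measurable_tailInd a x)
    (abs_tailInd_le_one a x)
  rw [integral_tailInd] at h
  refine h.trans (ENNReal.ofReal_le_ofReal ?_)
  gcongr
  have h1 : ∫ q, tailInd a x q ^ 2 ∂F ≤ ∫ _, (1 : ℝ) ∂F := by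
    refine integral_mono_of_nonneg (Filter.Eventually.of_forall fun q => sq_nonneg _)
      (integrable_const _) (Filter.Eventually.of_forall fun q => ?_)
    exact (sq_le_one_iff_abs_le_one _).2 (abs_tailInd_le_one a x q)
  simpa using h1

theorem integrable_tailInd [IsFiniteMeasure F] (u : ℝ) : Integrable (tailInd a u) F :=
  (integrable_const (1 : ℝ)).mono' (measurable_tailInd a u).aestronglyMeasurable
    (Filter.Eventually.of_forall fun q => abs_tailInd_le_one a u q)

theorem integral_sq_tailInd_sub [IsFiniteMeasure F] (x u : ℝ) :
    ∫ q, (tailInd a u q - tailInd a x q) ^ 2 ∂F = |tailProb F a u - tailProb F a x| := by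
  wlog h : u ≤ x generalizing x u
  · rw [abs_sub_comm, ← this u x (le_of_not_ge h)]
    exact integral_congr_ae (Filter.Eventually.of_forall fun q => by ring)
  rw [abs_of_nonneg (sub_nonneg.2 (tailProb_antitone a h)), ← integral_tailInd, ← integral_tailInd,
    ← integral_sub (integrable_tailInd u) (integrable_tailInd x)]
  refine integral_congr_ae (Filter.Eventually.of_forall fun q => ?_)
  classical
  simp only [tailInd_eq]
  split_ifs <;> first | (norm_num; done) | (exfalso; linarith)

/-- The increments of the tail deviation have variance of the order of their length, divided by
the sample size. -/
theorem lintegral_sq_tailDev_sub_le [IsProbabilityMeasure F] (hN : 0 < N)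
    (hI : ∀ τ, HasLaw (I τ) F Pr) (hind : iIndepFun I Pr) (x u : ℝ) :
    ∫⁻ ω, ENNReal.ofReal
        ((tailDev F (fun τ => I τ ω) a u - tailDev F (fun τ => I τ ω) a x) ^ 2) ∂Pr
      ≤ ENNReal.ofReal (|tailProb F a u - tailProb F a x| / N) := by
  have h := lintegral_sq_average_sub_integral_le hN hI hind
    ((measurable_tailInd a u).sub (measurable_tailInd a x)) (C := 2) fun q => by
      have h1 := abs_sub (tailInd a u q) (tailInd a x q)
      have h2 := abs_tailInd_le_one a u q
      have h3 := abs_tailInd_le_one a x q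
      simp only [Pi.sub_apply]
      linarith
  simp only [Pi.sub_apply] at h
  rw [integral_sq_tailInd_sub, integral_sub (integrable_tailInd u) (integrable_tailInd x),
    integral_tailInd, integral_tailInd] at h
  refine (lintegral_congr fun ω => ?_).trans_le h
  unfold tailDev
  rw [Finset.sum_sub_distrib]
  congr 2
  ring

omit [IsProbabilityMeasure Pr] in
theorem aemeasurable_uncurry_tailDev [IsFiniteMeasure F] (hI : ∀ τ, HasLaw (I τ) F Pr)
    (ν : Measure ℝ) [SFinite ν] :
    AEMeasurable (fun p : S × ℝ => tailDev F (fun τ => I τ p.1) a p.2) (Pr.prod ν) := by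
  unfold tailDev
  refine AEMeasurable.sub (AEMeasurable.const_mul (Finset.aemeasurable_fun_sum _ fun τ _ => ?_) _)
    ((tailProb_antitone a).measurable.comp measurable_snd).aemeasurable
  exact (measurable_uncurry_tailInd a).comp_aemeasurable
    (measurable_snd.aemeasurable.prodMk (hI τ).aemeasurable.comp_fst)

/-- The weighted square deviation `∫ (h(u) - h(x))² / |u - x| du` of the tail deviation `h` around
`x`. At `u = x` the integrand is `0`. -/
noncomputable def tailOsc (F : Measure (Query m)) (I : Fin N → Query m) (a : Fin m → ℝ)
    (J : Set ℝ) (x : ℝ) : ENNReal :=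
  ∫⁻ u in J, ENNReal.ofReal ((tailDev F I a u - tailDev F I a x) ^ 2 / |u - x|)

omit [IsProbabilityMeasure Pr] in
theorem aemeasurable_tailDev (hI : ∀ τ, HasLaw (I τ) F Pr) (x : ℝ) :
    AEMeasurable (fun ω => tailDev F (fun τ => I τ ω) a x) Pr := by
  unfold tailDev
  refine AEMeasurable.sub (AEMeasurable.const_mul
    (Finset.aemeasurable_fun_sum _ fun τ _ => ?_) _) aemeasurable_const
  exact (measurable_tailInd a x).comp_aemeasurable (hI τ).aemeasurable

omit [IsProbabilityMeasure Pr] in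
theorem aemeasurable_uncurry_tailOsc_integrand [IsFiniteMeasure F]
    (hI : ∀ τ, HasLaw (I τ) F Pr) (ν : Measure ℝ) [SFinite ν] (x : ℝ) :
    AEMeasurable (Function.uncurry fun (ω : S) (u : ℝ) => ENNReal.ofReal
      ((tailDev F (fun τ => I τ ω) a u - tailDev F (fun τ => I τ ω) a x) ^ 2 / |u - x|))
      (Pr.prod ν) :=
  ((((aemeasurable_uncurry_tailDev hI ν).sub (aemeasurable_tailDev hI x).comp_fst).pow_const 2).div
    (measurable_snd.sub_const x).norm.aemeasurable).ennreal_ofReal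

omit [IsProbabilityMeasure Pr] in
theorem aemeasurable_tailOsc [IsFiniteMeasure F] (hI : ∀ τ, HasLaw (I τ) F Pr) (J : Set ℝ)
    (x : ℝ) : AEMeasurable (fun ω => tailOsc F (fun τ => I τ ω) a J x) Pr :=
  (aemeasurable_uncurry_tailOsc_integrand hI (volume.restrict J) x).lintegral_prod_right

/-- The weight `1 / |u - x|` is compensated by the factor `|u - x|` in the variance of
`h(u) - h(x)`. -/
theorem lintegral_tailOsc_le [IsProbabilityMeasure F] (hN : 0 < N)
    (hI : ∀ τ, HasLaw (I τ) F Pr) (hind : iIndepFun I Pr) {J : Set ℝ} (hJ : MeasurableSet J)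
    {K : ℝ} (hK : ∀ x ∈ J, ∀ y ∈ J, |tailProb F a y - tailProb F a x| ≤ K * |y - x|) {x : ℝ}
    (hx : x ∈ J) :
    ∫⁻ ω, tailOsc F (fun τ => I τ ω) a J x ∂Pr ≤ ENNReal.ofReal (K / N) * volume J := by
  unfold tailOsc
  rw [lintegral_lintegral_swap]
  · refine (setLIntegral_mono' hJ (g := fun _ => ENNReal.ofReal (K / N)) fun u hu => ?_).trans_eq
      (setLIntegral_const _ _)
    rcases eq_or_ne u x with rfl | hne
    · simp
    have hpos : 0 < |u - x| := abs_pos.2 (sub_ne_zero.2 hne)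
    simp only [ENNReal.ofReal_div_of_pos hpos]
    simp only [div_eq_mul_inv]
    rw [lintegral_mul_const' _ _ (by simpa using sub_ne_zero.2 hne), ← div_eq_mul_inv]
    refine ENNReal.div_le_of_le_mul ?_
    refine (lintegral_sq_tailDev_sub_le hN hI hind x u).trans ?_
    rw [← ENNReal.ofReal_mul' hpos.le]
    refine ENNReal.ofReal_le_ofReal ?_
    rw [← div_eq_mul_inv, div_mul_eq_mul_div]
    gcongr
    exact hK x hx u hu
  · exact aemeasurable_uncurry_tailOsc_integrand hI _ x

/-- Splitting `h(u) = h(x) + g(u)`, this is `|h(x)| |y - x| ≤ ε (y - x)² + h(x)² / (4 ε)` together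
with a Cauchy–Schwarz inequality with weight `|u - x|`, used in the additive form
`|g(u)| ≤ ε |u - x| + g(u)² / (4 ε |u - x|)`. -/
theorem enorm_intervalIntegral_le (h : ℝ → ℝ) {J : Set ℝ} {x y : ℝ} (hJ : uIcc x y ⊆ J)
    {ε : ℝ} (hε : 0 < ε) :
    ‖∫ u in x..y, h u‖ₑ ≤ ENNReal.ofReal (2 * ε * (y - x) ^ 2) + ENNReal.ofReal (1 / (4 * ε)) *
      (ENNReal.ofReal (h x ^ 2) + ∫⁻ u in J, ENNReal.ofReal ((h u - h x) ^ 2 / |u - x|)) := by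
  have hε4 : 0 < 4 * ε := by positivity
  have hpt : ∀ u ∈ uIoc x y, ‖h u‖ₑ ≤ ENNReal.ofReal (|h x| + ε * |y - x|) +
      ENNReal.ofReal (1 / (4 * ε)) * ENNReal.ofReal ((h u - h x) ^ 2 / |u - x|) := by
    intro u hu
    rw [← ENNReal.ofReal_mul (by positivity), ← ENNReal.ofReal_add (by positivity) (by positivity),
      Real.enorm_eq_ofReal_abs]
    refine ENNReal.ofReal_le_ofReal ?_
    have h1 : |h u| ≤ |h x| + |h u - h x| := by
      have := abs_add_le (h x) (h u - h x)
      rwa [add_sub_cancel] at this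
    have h2 : |u - x| ≤ |y - x| := abs_sub_left_of_mem_uIcc (uIoc_subset_uIcc hu)
    rcases eq_or_ne u x with rfl | hne
    · have : 0 ≤ ε * |y - u| := by positivity
      simpa using this
    have hpos : 0 < |u - x| := abs_pos.2 (sub_ne_zero.2 hne)
    have h3 : |h u - h x| ≤ ε * |u - x| + 1 / (4 * ε) * ((h u - h x) ^ 2 / |u - x|) := by
      rw [← sq_abs (h u - h x)]
      have h4 : ε * |u - x| + 1 / (4 * ε) * (|h u - h x| ^ 2 / |u - x|) - |h u - h x|
          = (|h u - h x| - 2 * ε * |u - x|) ^ 2 / (4 * ε * |u - x|) := by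
        field_simp
        ring
      have h5 : 0 ≤ (|h u - h x| - 2 * ε * |u - x|) ^ 2 / (4 * ε * |u - x|) := by positivity
      linarith
    have h6 : ε * |u - x| ≤ ε * |y - x| := by gcongr
    linarith
  have hvol : volume (uIoc x y) = ENNReal.ofReal |y - x| := by
    rw [uIoc, Real.volume_Ioc, max_sub_min_eq_abs]
  have hx : (|h x| + ε * |y - x|) * |y - x| ≤ 2 * ε * (y - x) ^ 2 + 1 / (4 * ε) * h x ^ 2 := by
    rw [← sq_abs (y - x), ← sq_abs (h x)]
    have h4 : 2 * ε * |y - x| ^ 2 + 1 / (4 * ε) * |h x| ^ 2 - (|h x| + ε * |y - x|) * |y - x|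
        = (|h x| - 2 * ε * |y - x|) ^ 2 / (4 * ε) := by
      field_simp
      ring
    have h5 : 0 ≤ (|h x| - 2 * ε * |y - x|) ^ 2 / (4 * ε) := by positivity
    linarith
  calc ‖∫ u in x..y, h u‖ₑ = ‖∫ u in uIoc x y, h u‖ₑ := by
        rw [← ofReal_norm, ← ofReal_norm, intervalIntegral.norm_intervalIntegral_eq]
    _ ≤ ∫⁻ u in uIoc x y, ‖h u‖ₑ := enorm_integral_le_lintegral_enorm _
    _ ≤ ∫⁻ u in uIoc x y, (ENNReal.ofReal (|h x| + ε * |y - x|) +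
          ENNReal.ofReal (1 / (4 * ε)) * ENNReal.ofReal ((h u - h x) ^ 2 / |u - x|)) :=
        setLIntegral_mono' measurableSet_uIoc hpt
    _ = ENNReal.ofReal ((|h x| + ε * |y - x|) * |y - x|) + ENNReal.ofReal (1 / (4 * ε)) *
          ∫⁻ u in uIoc x y, ENNReal.ofReal ((h u - h x) ^ 2 / |u - x|) := by
        rw [lintegral_add_left measurable_const, setLIntegral_const, hvol,
          lintegral_const_mul' _ _ ENNReal.ofReal_ne_top, ENNReal.ofReal_mul (by positivity)]
    _ ≤ (ENNReal.ofReal (2 * ε * (y - x) ^ 2) + ENNReal.ofReal (1 / (4 * ε) * h x ^ 2)) +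
          ENNReal.ofReal (1 / (4 * ε)) *
            ∫⁻ u in J, ENNReal.ofReal ((h u - h x) ^ 2 / |u - x|) := by
        gcongr
        · rw [← ENNReal.ofReal_add (by positivity) (by positivity)]
          exact ENNReal.ofReal_le_ofReal hx
        · exact uIoc_subset_uIcc.trans hJ
    _ = _ := by
        rw [ENNReal.ofReal_mul (by positivity : 0 ≤ 1 / (4 * ε)), mul_add, add_assoc]

end Fluctuation

/-! ### Convergence of the dual minimizers -/

section Convergence

variable {m : ℕ} {F : Measure (Query m)} {𝒜 : Finset (Fin m → ℝ)}

theorem typeProb_pos (hF : IsQueryLaw F 𝒜) {a : Fin m → ℝ} (ha : a ∈ 𝒜) : 0 < typeProb F a := by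
  have := hF.isProb
  exact ENNReal.toReal_pos (hF.type_pos a ha) (measure_ne_top _ _)

/-- The pathwise bound: the squared distance of the two minimizers is controlled by the tail
deviations at the fluid minimizer and their oscillations around it. The terms `2 ε (y - x)²` of
`enorm_intervalIntegral_le` take up half of the quadratic growth. -/
theorem ofReal_sum_sq_le_tailOsc (hF : IsQueryLaw F 𝒜) {Ω : Set (Fin m → ℝ)}
    (hΩ : Convex ℝ Ω) {αlo αhi : ℝ} (hαlo : 0 < αlo) (hgrowth : GrowthCondition F 𝒜 Ω αlo αhi)
    {N : ℕ} {c : Fin m → ℝ} {I : Fin N → Query m} (hI : ∀ τ, (I τ).2 ∈ 𝒜) {μhat μ : Fin m → ℝ}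
    (hhat : μhat ∈ argminOn (fluidDual F N c) Ω) (hμ : μ ∈ argminOn (offDual c I) Ω) :
    ENNReal.ofReal (αlo / 16 * ∑ a ∈ 𝒜, typeProb F a * (a ⬝ᵥ μ - a ⬝ᵥ μhat) ^ 2)
      ≤ ∑ a ∈ 𝒜, ENNReal.ofReal (8 / (αlo * typeProb F a)) *
          (ENNReal.ofReal (tailDev F I a (a ⬝ᵥ μhat) ^ 2)
            + tailOsc F I a ((fun μ => a ⬝ᵥ μ) '' Ω) (a ⬝ᵥ μhat)) := by
  set Q := ∑ a ∈ 𝒜, typeProb F a * (a ⬝ᵥ μ - a ⬝ᵥ μhat) ^ 2 with hQ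
  have hQ0 : 0 ≤ Q := Finset.sum_nonneg fun a ha =>
    mul_nonneg (typeProb_pos hF ha).le (sq_nonneg _)
  have h1 : αlo / 16 * Q + αlo / 16 * Q
      ≤ ∑ a ∈ 𝒜, ∫ u in (a ⬝ᵥ μhat)..(a ⬝ᵥ μ), tailDev F I a u := by
    have h2 := quadratic_growth_fluidDual hF hΩ hgrowth hhat hμ.1
    have h3 := fluidDual_sub_le_sum_tailDev hF hI c (hμ.2 μhat hhat.1)
    linarith
  have h4 : ∀ a ∈ 𝒜, ‖∫ u in (a ⬝ᵥ μhat)..(a ⬝ᵥ μ), tailDev F I a u‖ₑ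
      ≤ ENNReal.ofReal (αlo / 16 * (typeProb F a * (a ⬝ᵥ μ - a ⬝ᵥ μhat) ^ 2))
        + ENNReal.ofReal (8 / (αlo * typeProb F a)) *
          (ENNReal.ofReal (tailDev F I a (a ⬝ᵥ μhat) ^ 2)
            + tailOsc F I a ((fun μ => a ⬝ᵥ μ) '' Ω) (a ⬝ᵥ μhat)) := by
    intro a ha
    have hp := typeProb_pos hF ha
    have hconv : Convex ℝ ((fun μ => a ⬝ᵥ μ) '' Ω) :=
      hΩ.is_linear_image ⟨fun x y => dotProduct_add a x y, fun r x => dotProduct_smul r a x⟩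
    have h5 := enorm_intervalIntegral_le (tailDev F I a) (ε := αlo * typeProb F a / 32)
      (hconv.ordConnected.uIcc_subset (mem_image_of_mem _ hhat.1) (mem_image_of_mem _ hμ.1))
      (by positivity)
    have e1 : 2 * (αlo * typeProb F a / 32) * (a ⬝ᵥ μ - a ⬝ᵥ μhat) ^ 2
        = αlo / 16 * (typeProb F a * (a ⬝ᵥ μ - a ⬝ᵥ μhat) ^ 2) := by ring
    have e2 : 1 / (4 * (αlo * typeProb F a / 32)) = 8 / (αlo * typeProb F a) := by
      field_simp
      norm_num
    rwa [e1, e2] at h5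
  refine (ENNReal.add_le_add_iff_left (ENNReal.ofReal_ne_top (r := αlo / 16 * Q))).1 ?_
  calc ENNReal.ofReal (αlo / 16 * Q) + ENNReal.ofReal (αlo / 16 * Q)
      = ENNReal.ofReal (αlo / 16 * Q + αlo / 16 * Q) :=
        (ENNReal.ofReal_add (by positivity) (by positivity)).symm
    _ ≤ ‖∑ a ∈ 𝒜, ∫ u in (a ⬝ᵥ μhat)..(a ⬝ᵥ μ), tailDev F I a u‖ₑ := by
        rw [Real.enorm_eq_ofReal_abs]
        exact ENNReal.ofReal_le_ofReal (h1.trans (le_abs_self _))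
    _ ≤ ∑ a ∈ 𝒜, ‖∫ u in (a ⬝ᵥ μhat)..(a ⬝ᵥ μ), tailDev F I a u‖ₑ := enorm_sum_le _ _
    _ ≤ _ := Finset.sum_le_sum h4
    _ = _ := by
        rw [Finset.sum_add_distrib, ← ENNReal.ofReal_sum_of_nonneg fun a ha => mul_nonneg
          (by positivity) (mul_nonneg (typeProb_pos hF ha).le (sq_nonneg _)), ← Finset.mul_sum]

end Convergence

/-- Dual convergence. Here `N = s - 1 = T - t` is the number of future queries; the constants depend
on `F`, `Ω` and the growth constants, not on `N` and `c`, nor on the choice of the minimizers. -/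
theorem lemma7 {m : ℕ} (F : Measure (Query m)) (𝒜 : Finset (Fin m → ℝ)) (hF : IsQueryLaw F 𝒜)
    (Ω : Set (Fin m → ℝ)) (hΩ_compact : IsCompact Ω) (hΩ_convex : Convex ℝ Ω)
    (hΩ_nonneg : ∀ μ ∈ Ω, 0 ≤ μ)
    (αlo αhi : ℝ) (hαlo : 0 < αlo) (hαhi : 0 < αhi)
    (hgrowth : GrowthCondition F 𝒜 Ω αlo αhi) :
    ∃ (δ₁ : ℝ) (t₀ : ℕ), 0 < δ₁ ∧ 0 < t₀ ∧
      ∀ (N : ℕ), t₀ ≤ N → ∀ (c : Fin m → ℝ), 0 ≤ c →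
      ∀ (S : Type*) [MeasurableSpace S] (Pr : Measure S) [IsProbabilityMeasure Pr]
        (I : Fin N → S → Query m),
        (∀ τ, HasLaw (I τ) F Pr) → iIndepFun I Pr →
      ∀ μtilde : S → (Fin m → ℝ), AEMeasurable μtilde Pr →
        (∀ᵐ ω ∂Pr, μtilde ω ∈ argminOn (offDual c (fun τ => I τ ω)) Ω) →
      ∀ μhat ∈ argminOn (fluidDual F N c) Ω,
      ∀ a ∈ 𝒜,
        Integrable (fun ω => (a ⬝ᵥ μtilde ω - a ⬝ᵥ μhat) ^ 2) Pr ∧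
        ∫ ω, (a ⬝ᵥ μtilde ω - a ⬝ᵥ μhat) ^ 2 ∂Pr ≤ δ₁ / N := by
  have hFprob := hF.isProb
  have hJ : ∀ a : Fin m → ℝ, IsCompact ((fun μ => a ⬝ᵥ μ) '' Ω) := fun a =>
    hΩ_compact.image (by unfold dotProduct; fun_prop)
  choose! K hK0 hK using fun a (ha : a ∈ 𝒜) =>
    exists_lipschitz_tailProb hΩ_compact hΩ_convex hgrowth ha
  set w : (Fin m → ℝ) → ℝ := fun a =>
    8 / (αlo * typeProb F a) * (1 + K a * volume.real ((fun μ => a ⬝ᵥ μ) '' Ω)) with hw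
  have hw0 : ∀ a ∈ 𝒜, 0 ≤ w a := fun a ha => by
    have h1 := hK0 a ha
    have h2 := typeProb_pos hF ha
    positivity
  have hfac0 : ∀ a ∈ 𝒜, 0 ≤ 16 / (αlo * typeProb F a) := fun a ha => by
    have h2 := typeProb_pos hF ha
    positivity
  have hD0 : 0 ≤ ∑ a ∈ 𝒜, 16 / (αlo * typeProb F a) * ∑ b ∈ 𝒜, w b :=
    Finset.sum_nonneg fun a ha => mul_nonneg (hfac0 a ha) (Finset.sum_nonneg hw0)
  -- The summand `1` only makes the constant positive.
  refine ⟨1 + ∑ a ∈ 𝒜, 16 / (αlo * typeProb F a) * ∑ b ∈ 𝒜, w b, 1, by positivity, one_pos, ?_⟩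
  intro N hN c _ S _ Pr _ I hI hind μtilde hμtilde hargmin μhat hhat a ha
  have hN0 : (0 : ℝ) < N := by exact_mod_cast hN
  have hsize : ∀ᵐ ω ∂Pr, ∀ τ, (I τ ω).2 ∈ 𝒜 := ae_all_iff.2 fun τ => by
    have h : ∀ᵐ q ∂(Pr.map (I τ)), q.2 ∈ 𝒜 := by
      rw [(hI τ).map_eq]
      exact hF.size_mem
    exact ae_of_ae_map (hI τ).aemeasurable h
  -- The expectation of the right-hand side of the pathwise bound.
  have hmean : ∫⁻ ω, ∑ b ∈ 𝒜, ENNReal.ofReal (8 / (αlo * typeProb F b)) *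
      (ENNReal.ofReal (tailDev F (fun τ => I τ ω) b (b ⬝ᵥ μhat) ^ 2)
        + tailOsc F (fun τ => I τ ω) b ((fun μ => b ⬝ᵥ μ) '' Ω) (b ⬝ᵥ μhat)) ∂Pr
      ≤ ENNReal.ofReal ((∑ b ∈ 𝒜, w b) / N) := by
    have hmeas : ∀ (b : Fin m → ℝ) (x : ℝ),
        AEMeasurable (fun ω => tailDev F (fun τ => I τ ω) b x) Pr := fun b x =>
      aemeasurable_tailDev hI x
    rw [lintegral_finsetSum' _ fun b _ => ?_, Finset.sum_div,
      ENNReal.ofReal_sum_of_nonneg fun b hb => div_nonneg (hw0 b hb) hN0.le]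
    · refine Finset.sum_le_sum fun b hb => ?_
      have hp := typeProb_pos hF hb
      have hKb := hK0 b hb
      rw [lintegral_const_mul' _ _ ENNReal.ofReal_ne_top,
        lintegral_add_left' ((hmeas b _).pow_const 2).ennreal_ofReal]
      calc _ ≤ ENNReal.ofReal (8 / (αlo * typeProb F b)) * (ENNReal.ofReal (1 / N)
            + ENNReal.ofReal (K b / N) * volume ((fun μ => b ⬝ᵥ μ) '' Ω)) := by
            gcongr
            · exact lintegral_sq_tailDev_le hN hI hind _
            · exact lintegral_tailOsc_le hN hI hind (hJ b).measurableSet (hK b hb)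
                (mem_image_of_mem _ hhat.1)
        _ = ENNReal.ofReal (w b / N) := by
            rw [← ofReal_measureReal (hJ b).measure_ne_top, ← ENNReal.ofReal_mul (by positivity),
              ← ENNReal.ofReal_add (by positivity) (by positivity),
              ← ENNReal.ofReal_mul (by positivity)]
            congr 1
            simp only [hw]
            ring
    · exact (((hmeas b _).pow_const 2).ennreal_ofReal.add (aemeasurable_tailOsc hI _ _)).const_mul _
  have hmain : ∫⁻ ω, ENNReal.ofReal ((a ⬝ᵥ μtilde ω - a ⬝ᵥ μhat) ^ 2) ∂Pr
      ≤ ENNReal.ofReal ((1 + ∑ a ∈ 𝒜, 16 / (αlo * typeProb F a) * ∑ b ∈ 𝒜, w b) / N) := by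
    have hp := typeProb_pos hF ha
    have hpath : ∀ᵐ ω ∂Pr, ENNReal.ofReal ((a ⬝ᵥ μtilde ω - a ⬝ᵥ μhat) ^ 2)
        ≤ ENNReal.ofReal (16 / (αlo * typeProb F a)) *
          ∑ b ∈ 𝒜, ENNReal.ofReal (8 / (αlo * typeProb F b)) *
            (ENNReal.ofReal (tailDev F (fun τ => I τ ω) b (b ⬝ᵥ μhat) ^ 2)
              + tailOsc F (fun τ => I τ ω) b ((fun μ => b ⬝ᵥ μ) '' Ω) (b ⬝ᵥ μhat)) := by
      filter_upwards [hsize, hargmin] with ω h1 h2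
      refine le_trans ?_
        (mul_le_mul_right (ofReal_sum_sq_le_tailOsc hF hΩ_convex hαlo hgrowth h1 hhat h2) _)
      rw [← ENNReal.ofReal_mul (by positivity)]
      refine ENNReal.ofReal_le_ofReal ?_
      have h3 := Finset.single_le_sum
        (f := fun b => typeProb F b * (b ⬝ᵥ μtilde ω - b ⬝ᵥ μhat) ^ 2)
        (fun b hb => mul_nonneg (typeProb_pos hF hb).le (sq_nonneg _)) ha
      calc (a ⬝ᵥ μtilde ω - a ⬝ᵥ μhat) ^ 2
          = 16 / (αlo * typeProb F a) *
              (αlo / 16 * (typeProb F a * (a ⬝ᵥ μtilde ω - a ⬝ᵥ μhat) ^ 2)) := by field_simp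
        _ ≤ _ := by gcongr
    refine (lintegral_mono_ae hpath).trans ?_
    rw [lintegral_const_mul' _ _ ENNReal.ofReal_ne_top]
    refine (mul_le_mul_right hmean _).trans ?_
    rw [← ENNReal.ofReal_mul (hfac0 a ha), ← mul_div_assoc]
    refine ENNReal.ofReal_le_ofReal ?_
    gcongr
    have h4 := Finset.single_le_sum
      (f := fun a => 16 / (αlo * typeProb F a) * ∑ b ∈ 𝒜, w b)
      (fun b hb => mul_nonneg (hfac0 b hb) (Finset.sum_nonneg hw0)) ha
    linarith
  have hsm : AEStronglyMeasurable (fun ω => (a ⬝ᵥ μtilde ω - a ⬝ᵥ μhat) ^ 2) Pr := by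
    have hdot : Measurable fun μ : Fin m → ℝ => a ⬝ᵥ μ := by
      unfold dotProduct
      fun_prop
    exact (((hdot.comp_aemeasurable hμtilde).sub_const _).pow_const 2).aestronglyMeasurable
  have hnn : 0 ≤ᵐ[Pr] fun ω => (a ⬝ᵥ μtilde ω - a ⬝ᵥ μhat) ^ 2 :=
    Filter.Eventually.of_forall fun ω => sq_nonneg _
  refine ⟨⟨hsm, ?_⟩, ?_⟩
  · rw [hasFiniteIntegral_iff_ofReal hnn]
    exact hmain.trans_lt ENNReal.ofReal_lt_top
  · rw [integral_eq_lintegral_of_nonneg_ae hnn hsm]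
    exact ENNReal.toReal_le_of_le_ofReal (by positivity) hmain
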